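/- For every $L\in\mathbb N$ let $H=H_L$ be a Hermitian operator on a $2^L$-dimensional Hilbert space whose eigenvalues, counted with multiplicity, are $E_{\boldsymbol n}=\sum_{k=1}^{L}n_k\Lambda_k+E_0$, $n_k\in\{0,1\}$, where the one-particle energies $\Lambda_k\in\mathbb R$ and the offset $E_0\in\mathbb R$ may depend on $L$. Let $\epsilon_1,\dots,\epsilon_{L_B}$ be the distinct values among $\Lambda_1,\dots,\Lambda_L$ and let $g_j$ be the number of $k$ with $\Lambda_k=\epsilon_j$. Let $\chi(t)=\operatorname{tr}(e^{-itH})$ (infinite temperature). Time $t$ is regarded as a random variable with expectation $\overline{f(t)}=\lim_{T\to\infty}\frac1T\int_0^T f(t)\,dt$; thus the distribution of a real function $X(t)$ of time is the (unique) Borel probability measure $\mu$ on $\mathbb R$, if it exists, with $\overline{f(X(t))}=\int f\,d\mu$ for all bounded continuous $f:\mathbb R\to\mathbb R$. Assume that for every $L$ the numbers $\epsilon_1,\dots,\epsilon_{L_B}$ are linearly independent over $\mathbb Q$, and that there is a real $q>2$ such that $$\lim_{L\to\infty}S_q^{L_B}=0,\qquad S_q^{L_B}:=\frac{\sum_{j=1}^{L_B}g_j^{q}}{\bigl(\sum_{j=1}^{L_B}g_j^2\bigr)^{q/2}}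 .$$ Then for every $L$ the random variables $\ln|\chi(t)|^2\big/\sqrt{\sum_j g_j^2}$ (the logarithm may be given any value at the isolated times where $\chi(t)=0$) and $|\chi(t)|^{2/\sqrt{\sum_j g_j^2}}$ have distributions in the above sense, and as $L\to\infty$ these converge weakly: $$\frac{\ln|\chi(t)|^2}{\sqrt{\sum_{j=1}^{L_B}g_j^2}}\ \longrightarrow\ \mathsf N\Bigl(0,\frac{\pi^2}{3}\Bigr),\qquad |\chi(t)|^{2/\sqrt{\sum_{j=1}^{L_B}g_j^2}}\ \longrightarrow\ \mathsf{LogNormal}\Bigl(0,\frac{\pi^2}{3}\Bigr),$$ where $\mathsf{LogNormal}(0,\sigma^2)$ is the law of $e^Z$ with $Z\sim\mathsf N(0,\sigma^2)$. Moreover $\pi^2/3$ is the variance of the uniform distribution on $[0,2\pi]$. (For $L=0$ the sum $\sum_j g_j^2$ is empty; division by $0$ is read as giving $0$ there, which does not affect the limits.) -/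

import Mathlib

open MeasureTheory ProbabilityTheory Filter Topology

noncomputable section

/-- The energy of the free-fermion configuration with occupation numbers `n k = 0, 1`, for the
one-particle spectrum `Λ` and the offset `E₀`. -/
def manyBodyEnergy {L : ℕ} (Λ : Fin L → ℝ) (E₀ : ℝ) (n : Fin L → Fin 2) : ℝ :=
  ∑ k, ((n k : ℕ) : ℝ) * Λ k + E₀

/-- `H` is a Hamiltonian on a Hilbert space of dimension `2 ^ L` whose eigenvalues, counted with
multiplicity, are the `2 ^ L` many-body energies of the one-particle spectrum `Λ`. -/
structure IsFreeFermion {L : ℕ} (H : Matrix (Fin (2 ^ L)) (Fin (2 ^ L)) ℂ)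
    (Λ : Fin L → ℝ) (E₀ : ℝ) : Prop where
  isHermitian : H.IsHermitian
  eigenvalues_eq : H.charpoly.roots =
    (Finset.univ : Finset (Fin L → Fin 2)).val.map (fun n => (manyBodyEnergy Λ E₀ n : ℂ))

/-- The infinite-temperature amplitude `χ(t) = tr (exp (-i t H))`. -/
def chi {N : ℕ} (H : Matrix (Fin N) (Fin N) ℂ) (t : ℝ) : ℂ :=
  Matrix.trace (NormedSpace.exp ((-(Complex.I * (t : ℂ))) • H))

/-- The distinct one-particle energies `ε_j`. -/
def distinctEnergies {L : ℕ} (Λ : Fin L → ℝ) : Finset ℝ :=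
  Finset.univ.image Λ

/-- The degeneracy of the one-particle energy `ε`. -/
def degeneracy {L : ℕ} (Λ : Fin L → ℝ) (ε : ℝ) : ℕ :=
  (Finset.univ.filter (fun k => Λ k = ε)).card

/-- The sum of the squared degeneracies, over the distinct one-particle energies. -/
def sumSqDegeneracy {L : ℕ} (Λ : Fin L → ℝ) : ℝ :=
  ∑ ε ∈ distinctEnergies Λ, (degeneracy Λ ε : ℝ) ^ 2

/-- The ratio `S_q = (∑ g_j ^ q) / (∑ g_j ^ 2) ^ (q / 2)`. -/
def lyapunovRatio {L : ℕ} (q : ℝ) (Λ : Fin L → ℝ) : ℝ :=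
  (∑ ε ∈ distinctEnergies Λ, (degeneracy Λ ε : ℝ) ^ q) / sumSqDegeneracy Λ ^ (q / 2)

/-- `μ` is the distribution of `X(t)` when the time `t` is regarded as a random variable whose
expectation is the infinite-time average `lim_{T → ∞} (1 / T) ∫_0^T`. -/
def HasTimeLaw (X : ℝ → ℝ) (μ : ProbabilityMeasure ℝ) : Prop :=
  Measurable X ∧ ∀ f : BoundedContinuousFunction ℝ ℝ,
    Tendsto (fun T : ℝ => (1 / T) * ∫ t in (0 : ℝ)..T, f (X t)) atTop
      (𝓝 (∫ x, f x ∂(μ : Measure ℝ)))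

/-- The normal distribution with mean `m` and variance `v`. -/
def normalLaw (m : ℝ) (v : NNReal) : ProbabilityMeasure ℝ :=
  ⟨gaussianReal m v, inferInstance⟩

/-- The log-normal distribution: the law of `exp Z` where `Z` is normal with mean `m` and
variance `v`. -/
def logNormalLaw (m : ℝ) (v : NNReal) : ProbabilityMeasure ℝ :=
  (normalLaw m v).map Real.measurable_exp.aemeasurable

end

/-! Grouping equal one-particle energies gives `|χ(t)| = ∏ |1 + exp (i ε_j t)| ^ g_j`, so off a null
set of times `ln |χ|²` is `∑ g_j y(ε_j t)` with the single function `y(θ) = log |1 + exp (i θ)|²`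
(`logSqNorm`).

Rational independence makes the phases `ε_j t` behave under time averages like independent uniform
angles. Since `y` is unbounded, Weyl's theorem is applied to the factors `exp (i u a_j y)`. These
are bounded and measurable but not continuous, hence the version `tendsto_timeAverage_prod`. With
Lévy's theorem this yields the law for each fixed `L` (`exists_hasTimeLaw_sum`).

The variable `y` has mean `0` and variance `2 ζ(2) = π² / 3`, by orthogonality of the Fourier modes
in `log (1 + r z)` and the limit `r → 1` (`integral_logSqNorm`, `integral_logSqNorm_sq`). The
normalized characteristic function is `∏ φ(u a_j)` with `a_j = g_j / √(∑ g²)` and `∑ a_j² = 1`. As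
all summands are multiples of one variable of finite variance, a central limit theorem needs only
`max a_j → 0` (`tendsto_prod_of_isLittleO`), and `(max a_j) ^ q ≤ S_q`. The log-normal limit is the
image under `exp`. -/

/-! ### Time averages of quasi-periodic functions -/

/-- The average of `f` over the time interval `[0, S]`. -/
noncomputable def timeAverage {E : Type*} [NormedAddCommGroup E] [NormedSpace ℝ E]
    (f : ℝ → E) (S : ℝ) : E :=
  S⁻¹ • ∫ t in (0 : ℝ)..S, f t

lemma intervalIntegrable_of_measurable_of_bound {E : Type*} [NormedAddCommGroup E]
    [MeasurableSpace E] [BorelSpace E] [SecondCountableTopology E]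
    {f : ℝ → E} (hf : Measurable f) {C : ℝ} (hC : ∀ t, ‖f t‖ ≤ C) (a b : ℝ) :
    IntervalIntegrable f volume a b :=
  (intervalIntegrable_const (c := C)).mono_fun hf.aestronglyMeasurable
    (Eventually.of_forall fun t => (hC t).trans (le_abs_self C))

section TimeAverage

variable {E : Type*} [NormedAddCommGroup E] [NormedSpace ℝ E]

lemma timeAverage_add {f g : ℝ → E} (hf : ∀ S, IntervalIntegrable f volume 0 S)
    (hg : ∀ S, IntervalIntegrable g volume 0 S) (S : ℝ) :
    timeAverage (fun t => f t + g t) S = timeAverage f S + timeAverage g S := by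
  simp only [timeAverage, intervalIntegral.integral_add (hf S) (hg S), smul_add]

lemma timeAverage_sub {f g : ℝ → E} (hf : ∀ S, IntervalIntegrable f volume 0 S)
    (hg : ∀ S, IntervalIntegrable g volume 0 S) (S : ℝ) :
    timeAverage (fun t => f t - g t) S = timeAverage f S - timeAverage g S := by
  simp only [timeAverage, intervalIntegral.integral_sub (hf S) (hg S), smul_sub]

lemma timeAverage_const_mul (c : ℂ) (f : ℝ → ℂ) (S : ℝ) :
    timeAverage (fun t => c * f t) S = c * timeAverage f S := by
  simp only [timeAverage, intervalIntegral.integral_const_mul, mul_smul_comm]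

lemma timeAverage_const [CompleteSpace E] (c : E) {S : ℝ} (hS : S ≠ 0) :
    timeAverage (fun _ => c) S = c := by
  simp [timeAverage, smul_smul, hS]

lemma norm_timeAverage_le {f : ℝ → E} {g : ℝ → ℝ} {S : ℝ} (hS : 0 ≤ S)
    (hfg : ∀ t, ‖f t‖ ≤ g t) (hg : IntervalIntegrable g volume 0 S) :
    ‖timeAverage f S‖ ≤ timeAverage g S := by
  rw [timeAverage, timeAverage, norm_smul, smul_eq_mul, norm_inv, Real.norm_of_nonneg hS]
  gcongr
  exact intervalIntegral.norm_integral_le_of_norm_le hS (Eventually.of_forall fun t _ => hfg t) hg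

lemma tendsto_timeAverage_exp {a : ℝ} (ha : a ≠ 0) :
    Tendsto (timeAverage fun t : ℝ => Complex.exp ((a * Complex.I) * t)) atTop (𝓝 0) := by
  have hc : (a * Complex.I : ℂ) ≠ 0 := by simp [ha]
  have hlim : Tendsto (fun S : ℝ => S⁻¹ * (2 / |a|)) atTop (𝓝 0) := by
    simpa using tendsto_inv_atTop_zero.mul_const (2 / |a|)
  refine squeeze_zero_norm' ?_ hlim
  filter_upwards [eventually_ge_atTop 0] with S hS
  rw [timeAverage, norm_smul, norm_inv, Real.norm_of_nonneg hS, integral_exp_mul_complex hc]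
  gcongr
  rw [norm_div]
  have h1 : ‖(a * Complex.I : ℂ)‖ = |a| := by simp
  rw [h1]
  gcongr
  refine (norm_sub_le _ _).trans ?_
  have h2 : ∀ x : ℝ, ‖Complex.exp (a * Complex.I * x)‖ = 1 := fun x => by
    rw [show (a * Complex.I * x : ℂ) = ((a * x : ℝ) : ℂ) * Complex.I by push_cast; ring]
    exact Complex.norm_exp_ofReal_mul_I _
  rw [h2, h2]
  norm_num

end TimeAverage

/-! ### Equidistribution of linear flows with rationally independent frequencies -/

section Circle

open AddCircle

variable {T : ℝ}

lemma measurable_comp_coe_mul {α : Type*} [MeasurableSpace α] {h : AddCircle T → α}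
    (hh : Measurable h) (ω : ℝ) :
    Measurable fun t : ℝ => h ((ω * t : ℝ) : AddCircle T) :=
  hh.comp (((AddCircle.continuous_mk' T).comp (continuous_const_mul ω)).measurable)

variable [hT : Fact (0 < T)]

lemma intervalIntegral_circle_eq {E : Type*} [NormedAddCommGroup E] [NormedSpace ℝ E]
    (k : AddCircle T → E) (a : ℝ) :
    ∫ t in a..a + T, k t = T • ∫ x, k x ∂haarAddCircle := by
  rw [AddCircle.intervalIntegral_preimage, integral_haarAddCircle, smul_smul,
    mul_inv_cancel₀ hT.out.ne', one_smul]

lemma intervalIntegral_period_eq (k : AddCircle T → ℝ) {ω : ℝ} (hω : ω ≠ 0) :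
    ∫ t in (0 : ℝ)..T / |ω|, k ((ω * t : ℝ) : AddCircle T) =
      T / |ω| * ∫ x, k x ∂haarAddCircle := by
  rw [intervalIntegral.integral_comp_mul_left (fun s : ℝ => k (s : AddCircle T)) hω]
  rcases hω.lt_or_gt with h | h
  · have h1 := intervalIntegral_circle_eq k (-T)
    rw [neg_add_cancel] at h1
    rw [abs_of_neg h, mul_zero, show ω * (T / -ω) = -T by field_simp,
      intervalIntegral.integral_symm, h1, smul_eq_mul, smul_eq_mul]
    field_simp
  · have h1 := intervalIntegral_circle_eq k 0
    rw [zero_add] at h1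
    rw [abs_of_pos h, mul_zero, show ω * (T / ω) = T by field_simp, h1, smul_eq_mul, smul_eq_mul]
    field_simp

/-- The time average of a nonnegative function along a rotation of the circle is eventually
at most twice its mean. -/
lemma eventually_timeAverage_le {k : AddCircle T → ℝ} (hk : Measurable k) (hk0 : ∀ x, 0 ≤ k x)
    {C : ℝ} (hC : ∀ x, k x ≤ C) {ω : ℝ} (hω : ω ≠ 0) :
    ∀ᶠ S in atTop, timeAverage (fun t => k ((ω * t : ℝ) : AddCircle T)) S ≤
      2 * ∫ x, k x ∂haarAddCircle := by
  set g : ℝ → ℝ := fun t => k ((ω * t : ℝ) : AddCircle T) with hg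
  have hint : ∀ a b, IntervalIntegrable g volume a b :=
    intervalIntegrable_of_measurable_of_bound (measurable_comp_coe_mul hk ω) (C := C)
      fun t => by rw [Real.norm_of_nonneg (hk0 _)]; exact hC _
  have hp : 0 < T / |ω| := div_pos hT.out (abs_pos.mpr hω)
  have hper : Function.Periodic g (T / |ω|) := fun t => by
    have h : ω * (T / |ω|) = T ∨ ω * (T / |ω|) = -T := by
      rcases hω.lt_or_gt with h | h
      · right; rw [abs_of_neg h]; field_simp
      · left; rw [abs_of_pos h]; field_simp
    rcases h with h | h <;> simp [hg, mul_add, h]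
  have hI : 0 ≤ ∫ x, k x ∂haarAddCircle := integral_nonneg hk0
  filter_upwards [eventually_ge_atTop (T / |ω|)] with S hS
  have hS0 : 0 < S := hp.trans_le hS
  -- Cover `[0, S]` by whole periods. Once `S` exceeds one period, rounding up at most doubles its
  -- length, whence the factor `2`.
  have h1 : S ≤ ⌈S / (T / |ω|)⌉ * (T / |ω|) := by
    rw [← div_le_iff₀ hp]; exact Int.le_ceil _
  have h2 : (⌈S / (T / |ω|)⌉ : ℝ) * (T / |ω|) ≤ 2 * S := by
    have := (Int.ceil_lt_add_one (S / (T / |ω|))).le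
    calc (⌈S / (T / |ω|)⌉ : ℝ) * (T / |ω|) ≤ (S / (T / |ω|) + 1) * (T / |ω|) := by gcongr
      _ = S + T / |ω| := by rw [add_mul, div_mul_cancel₀ _ hp.ne', one_mul]
      _ ≤ 2 * S := by linarith
  have h3 : ∫ t in (0 : ℝ)..S, g t ≤ ⌈S / (T / |ω|)⌉ * ((T / |ω|) * ∫ x, k x ∂haarAddCircle) := by
    have h4 := hper.intervalIntegral_add_zsmul_eq ⌈S / (T / |ω|)⌉ 0 hint
    rw [zero_add, zero_add, zsmul_eq_mul, zsmul_eq_mul, hg,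
      intervalIntegral_period_eq k hω] at h4
    rw [← h4]
    exact intervalIntegral.integral_mono_interval le_rfl hS0.le h1
      (Eventually.of_forall fun t => hk0 _) (hint _ _)
  rw [timeAverage, smul_eq_mul, inv_mul_le_iff₀ hS0]
  refine h3.trans ?_
  rw [← mul_assoc, show S * (2 * ∫ x, k x ∂haarAddCircle) = 2 * S * ∫ x, k x ∂haarAddCircle by ring]
  gcongr

lemma integral_fourier (n : ℤ) :
    ∫ x : AddCircle T, fourier n x ∂haarAddCircle = if n = 0 then 1 else 0 := by
  have h := congrFun (fourierCoeff_fourier (T := T) n) 0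
  rw [fourierCoeff] at h
  simp only [neg_zero, fourier_zero, one_smul] at h
  rw [h, Pi.single_apply]
  simp [eq_comm]

/-- Continuous functions are dense in `L¹`, and trigonometric polynomials are uniformly dense among
them. Approximation in mean is what admits discontinuous `h`. -/
lemma exists_span_fourier_integral_norm_sub_le {h : AddCircle T → ℂ}
    (hh : Integrable h haarAddCircle) {δ : ℝ} (hδ : 0 < δ) :
    ∃ p ∈ Submodule.span ℂ (Set.range (fourier (T := T))),
      ∫ x, ‖h x - p x‖ ∂haarAddCircle ≤ δ := by
  obtain ⟨g, hg, hgi⟩ := hh.exists_boundedContinuous_integral_sub_le (half_pos hδ)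
  have hmem : (g.toContinuousMap : C(AddCircle T, ℂ)) ∈
      closure (Submodule.span ℂ (Set.range (fourier (T := T))) : Set C(AddCircle T, ℂ)) := by
    have := span_fourier_closure_eq_top (T := T)
    rw [← Submodule.topologicalClosure_coe, this]
    trivial
  obtain ⟨p, hp, hgp⟩ := Metric.mem_closure_iff.mp hmem _ (half_pos hδ)
  refine ⟨p, hp, ?_⟩
  have hpi : Integrable p haarAddCircle := p.continuous.integrable_of_hasCompactSupport
    (HasCompactSupport.of_compactSpace _)
  have hb : ∀ x, ‖g x - p x‖ ≤ δ / 2 := fun x => by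
    rw [← dist_eq_norm]
    exact (ContinuousMap.dist_apply_le_dist (f := g.toContinuousMap) (g := p) x).trans hgp.le
  calc ∫ x, ‖h x - p x‖ ∂haarAddCircle
      ≤ ∫ x, (‖h x - g x‖ + δ / 2) ∂haarAddCircle := by
        refine integral_mono (hh.sub hpi).norm ((hh.sub hgi).norm.add (integrable_const _))
          fun x => ?_
        calc ‖h x - p x‖ = ‖(h x - g x) + (g x - p x)‖ := by congr 1; ring
          _ ≤ _ := (norm_add_le _ _).trans (by gcongr; exact hb x)
    _ = (∫ x, ‖h x - g x‖ ∂haarAddCircle) + δ / 2 := by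
        rw [integral_add (f := fun x => ‖h x - g x‖) (hh.sub hgi).norm (integrable_const _)]; simp
    _ ≤ δ := by linarith

lemma integrable_of_measurable_of_bound {h : AddCircle T → ℂ} (hm : Measurable h) {C : ℝ}
    (hC : ∀ x, ‖h x‖ ≤ C) : Integrable h haarAddCircle :=
  Integrable.of_bound hm.aestronglyMeasurable C (Eventually.of_forall hC)

/-- If the time averages of `e(n ω t) G(t)` factorize in the limit for all Fourier monomials, then
so do those of `h(ω t) G(t)` for all bounded measurable `h` on the circle. -/
lemma tendsto_timeAverage_mul_of_fourier {G : ℝ → ℂ} (hG : Measurable G) (hG1 : ∀ t, ‖G t‖ ≤ 1)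
    {ω : ℝ} (hω : ω ≠ 0) {c : ℂ}
    (hc : ∀ n : ℤ, Tendsto
      (timeAverage fun t : ℝ => fourier n ((ω * t : ℝ) : AddCircle T) * G t) atTop
      (𝓝 ((∫ x : AddCircle T, fourier n x ∂haarAddCircle) * c)))
    {h : AddCircle T → ℂ} (hm : Measurable h) {C : ℝ} (hC : ∀ x, ‖h x‖ ≤ C) :
    Tendsto (timeAverage fun t : ℝ => h ((ω * t : ℝ) : AddCircle T) * G t) atTop
      (𝓝 ((∫ x, h x ∂haarAddCircle) * c)) := by
  have hint : ∀ {u : AddCircle T → ℂ} (_ : Measurable u) {D : ℝ} (_ : ∀ x, ‖u x‖ ≤ D) (S : ℝ),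
      IntervalIntegrable (fun t : ℝ => u ((ω * t : ℝ) : AddCircle T) * G t) volume 0 S := by
    intro u hu D hD S
    refine intervalIntegrable_of_measurable_of_bound ((measurable_comp_coe_mul hu ω).mul hG)
      (C := D) (fun t => ?_) _ _
    rw [Pi.mul_apply, norm_mul]
    calc _ ≤ D * 1 := mul_le_mul (hD _) (hG1 _) (norm_nonneg _) ((norm_nonneg _).trans (hD 0))
      _ = D := mul_one _
  have hcont : ∀ p : C(AddCircle T, ℂ), Integrable p haarAddCircle := fun p =>
    integrable_of_measurable_of_bound p.continuous.measurable p.norm_coe_le_norm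
  have hspan : ∀ p ∈ Submodule.span ℂ (Set.range (fourier (T := T))),
      Tendsto (timeAverage fun t : ℝ => p ((ω * t : ℝ) : AddCircle T) * G t) atTop
        (𝓝 ((∫ x, p x ∂haarAddCircle) * c)) := by
    intro p hp
    induction hp using Submodule.span_induction with
    | mem x hx => obtain ⟨n, rfl⟩ := hx; exact hc n
    | zero =>
      have e : timeAverage (fun _ : ℝ => (0 : ℂ)) = fun _ => 0 := by
        ext1 S; simp [timeAverage]
      simp [e]
    | add p r _ _ hp hr =>
      have e : ∀ S, timeAverage
          (fun t : ℝ => (p + r) ((ω * t : ℝ) : AddCircle T) * G t) S = _ := fun S => by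
        simp only [ContinuousMap.add_apply, add_mul]
        exact timeAverage_add (hint p.continuous.measurable p.norm_coe_le_norm)
          (hint r.continuous.measurable r.norm_coe_le_norm) S
      rw [show (∫ x, (p + r) x ∂haarAddCircle) =
        (∫ x, p x ∂haarAddCircle) + ∫ x, r x ∂haarAddCircle from
          integral_add (hcont p) (hcont r), add_mul]
      exact (hp.add hr).congr fun S => (e S).symm
    | smul a p _ hp =>
      have e : ∀ S, timeAverage
          (fun t : ℝ => (a • p) ((ω * t : ℝ) : AddCircle T) * G t) S = _ := fun S => by
        simp only [ContinuousMap.smul_apply, smul_eq_mul, mul_assoc]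
        exact timeAverage_const_mul a _ S
      simp only [ContinuousMap.smul_apply, smul_eq_mul, integral_const_mul, mul_assoc]
      exact (hp.const_mul a).congr fun S => by
        rw [← timeAverage_const_mul]
  rw [Metric.tendsto_nhds]
  intro η hη
  -- Replacing `h` by `p` costs `2 * δ` in the time average and `δ * ‖c‖` in the limit; `3` instead
  -- of `2` makes their sum strictly below `η / 4`.
  set δ : ℝ := η / (4 * (3 + ‖c‖)) with hδdef
  have hc0 := norm_nonneg c
  have hδ : 0 < δ := by positivity
  have hhi := integrable_of_measurable_of_bound hm hC
  obtain ⟨p, hp, hhp⟩ := exists_span_fourier_integral_norm_sub_le hhi hδ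
  have hkb : ∀ x, ‖h x - p x‖ ≤ C + ‖p‖ := fun x =>
    (norm_sub_le _ _).trans (add_le_add (hC x) (p.norm_coe_le_norm x))
  have hkm : Measurable fun x => ‖h x - p x‖ := (hm.sub p.continuous.measurable).norm
  filter_upwards [Metric.tendsto_nhds.mp (hspan p hp) (η / 4) (by positivity),
    eventually_timeAverage_le hkm (fun x => norm_nonneg _) hkb hω, eventually_ge_atTop 0]
    with S h1 h2 hS
  have e1 : ‖timeAverage (fun t : ℝ => h ((ω * t : ℝ) : AddCircle T) * G t) S -
      timeAverage (fun t : ℝ => p ((ω * t : ℝ) : AddCircle T) * G t) S‖ ≤ 2 * δ := by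
    rw [← timeAverage_sub (hint hm hC) (hint p.continuous.measurable p.norm_coe_le_norm)]
    refine (norm_timeAverage_le hS (fun t => ?_)
      (intervalIntegrable_of_measurable_of_bound (C := C + ‖p‖) (measurable_comp_coe_mul hkm ω)
        (fun t => ?_) 0 S)).trans (h2.trans (by gcongr))
    · rw [← sub_mul, norm_mul]
      exact mul_le_of_le_one_right (norm_nonneg _) (hG1 t)
    · rw [norm_norm]; exact hkb _
  have e2 : ‖(∫ x, p x ∂haarAddCircle) * c - (∫ x, h x ∂haarAddCircle) * c‖ ≤ δ * ‖c‖ := by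
    rw [← sub_mul, norm_mul, ← norm_neg, neg_sub, ← integral_sub hhi (hcont p)]
    gcongr
    exact (norm_integral_le_integral_norm _).trans hhp
  have e3 : 2 * δ + δ * ‖c‖ < η / 4 := by
    rw [show η / 4 = δ * (3 + ‖c‖) by rw [hδdef]; field_simp]
    nlinarith
  rw [dist_eq_norm] at h1 ⊢
  calc _ = ‖(timeAverage (fun t : ℝ => h ((ω * t : ℝ) : AddCircle T) * G t) S -
      timeAverage (fun t : ℝ => p ((ω * t : ℝ) : AddCircle T) * G t) S) +
      (timeAverage (fun t : ℝ => p ((ω * t : ℝ) : AddCircle T) * G t) S -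
        (∫ x, p x ∂haarAddCircle) * c) +
      ((∫ x, p x ∂haarAddCircle) * c - (∫ x, h x ∂haarAddCircle) * c)‖ := by congr 1; ring
    _ ≤ _ := norm_add₃_le
    _ < η := by linarith

lemma tendsto_timeAverage_prod_fourier {ι : Type*} (s : Finset ι) {ω : ι → ℝ}
    (hω : ∀ n : ι → ℤ, ∑ i ∈ s, (n i : ℝ) * ω i = 0 → ∀ i ∈ s, n i = 0) (n : ι → ℤ) :
    Tendsto (timeAverage fun t : ℝ => ∏ i ∈ s, fourier (n i) ((ω i * t : ℝ) : AddCircle T)) atTop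
      (𝓝 (∏ i ∈ s, ∫ x : AddCircle T, fourier (n i) x ∂haarAddCircle)) := by
  simp only [integral_fourier]
  by_cases h0 : ∀ i ∈ s, n i = 0
  · have e : ∀ t : ℝ, ∏ i ∈ s, fourier (n i) ((ω i * t : ℝ) : AddCircle T) = 1 := fun t =>
      Finset.prod_eq_one fun i hi => by rw [h0 i hi, fourier_zero]
    rw [Finset.prod_eq_one fun i hi => if_pos (h0 i hi)]
    simp only [e]
    refine tendsto_const_nhds.congr' ?_
    filter_upwards [eventually_ne_atTop 0] with S hS using (timeAverage_const _ hS).symm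
  · have hne : ∑ i ∈ s, (n i : ℝ) * ω i ≠ 0 := fun h => h0 (hω n h)
    push Not at h0
    obtain ⟨j, hj, hnj⟩ := h0
    rw [Finset.prod_eq_zero hj (if_neg hnj)]
    have hT0 : T ≠ 0 := hT.out.ne'
    have ha : 2 * Real.pi / T * ∑ i ∈ s, (n i : ℝ) * ω i ≠ 0 := by
      have := Real.pi_ne_zero
      positivity
    convert tendsto_timeAverage_exp ha using 2
    ext t
    simp only [fourier_coe_apply]
    rw [← Complex.exp_sum]
    congr 1
    push_cast
    rw [Finset.mul_sum, Finset.sum_mul, Finset.sum_mul]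
    refine Finset.sum_congr rfl fun i _ => ?_
    ring

/-- **Weyl equidistribution** for product functions: along a linear flow with rationally
independent frequencies the time average of a product of bounded measurable functions of the
individual phases is the product of their means. -/
theorem tendsto_timeAverage_prod {ι : Type*} [DecidableEq ι] (s : Finset ι) {ω : ι → ℝ}
    (hω : ∀ n : ι → ℤ, ∑ i ∈ s, (n i : ℝ) * ω i = 0 → ∀ i ∈ s, n i = 0)
    {h : ι → AddCircle T → ℂ} (hm : ∀ i, Measurable (h i)) (hb : ∀ i x, ‖h i x‖ ≤ 1) :
    Tendsto (timeAverage fun t : ℝ => ∏ i ∈ s, h i ((ω i * t : ℝ) : AddCircle T)) atTop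
      (𝓝 (∏ i ∈ s, ∫ x, h i x ∂haarAddCircle)) := by
  -- Induction on the set `r` of factors allowed to be arbitrary; the factors outside `r` are
  -- Fourier monomials.
  have key : ∀ r ⊆ s, ∀ h : ι → AddCircle T → ℂ, (∀ i, Measurable (h i)) →
      (∀ i x, ‖h i x‖ ≤ 1) → (∀ i ∈ s \ r, ∃ n : ℤ, h i = fourier n) →
      Tendsto (timeAverage fun t : ℝ => ∏ i ∈ s, h i ((ω i * t : ℝ) : AddCircle T)) atTop
        (𝓝 (∏ i ∈ s, ∫ x, h i x ∂haarAddCircle)) := by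
    intro r
    induction r using Finset.induction_on with
    | empty =>
      intro _ h _ _ hf
      simp only [Finset.sdiff_empty] at hf
      choose! n hn using hf
      have e := tendsto_timeAverage_prod_fourier (T := T) s hω n
      rw [Finset.prod_congr rfl fun i hi => by rw [hn i hi]]
      refine e.congr fun S => ?_
      congr 1
      ext t
      exact Finset.prod_congr rfl fun i hi => by rw [hn i hi]
    | insert a r har ih =>
      intro hrs h hm hb hf
      have has : a ∈ s := hrs (Finset.mem_insert_self a r)
      have hωa : ω a ≠ 0 := by
        intro h0
        have := hω (Pi.single a 1) (by
          rw [Finset.sum_eq_single a (fun b _ hba => by simp [hba]) (fun h => absurd has h), h0,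
            mul_zero]) a has
        simp at this
      set G : ℝ → ℂ := fun t => ∏ i ∈ s.erase a, h i ((ω i * t : ℝ) : AddCircle T) with hGdef
      have hG : Measurable G := Finset.measurable_fun_prod _ fun i _ =>
        measurable_comp_coe_mul (hm i) (ω i)
      have hG1 : ∀ t, ‖G t‖ ≤ 1 := fun t => by
        rw [hGdef, norm_prod]
        exact Finset.prod_le_one (fun _ _ => norm_nonneg _) fun i _ => hb i _
      have hmain := tendsto_timeAverage_mul_of_fourier (T := T) hG hG1 hωa
        (c := ∏ i ∈ s.erase a, ∫ x, h i x ∂haarAddCircle) (fun n => ?_) (hm a) (hb a)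
      · rw [← Finset.mul_prod_erase s _ has]
        refine hmain.congr fun S => ?_
        congr 1
        ext t
        exact Finset.mul_prod_erase s (fun i => h i ((ω i * t : ℝ) : AddCircle T)) has
      -- Overwriting the factor at `a` by a monomial leads back to the induction hypothesis, which
      -- supplies the monomial test required for `hmain`.
      · have hu : ∀ i ∈ s.erase a,
            Function.update h a (fourier n : AddCircle T → ℂ) i = h i := fun i hi =>
          Function.update_of_ne (Finset.ne_of_mem_erase hi) _ _
        have e := ih ((Finset.subset_insert a r).trans hrs)
          (Function.update h a (fourier n : AddCircle T → ℂ)) (fun i => ?_) (fun i x => ?_)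
          (fun i hi => ?_)
        · rw [← Finset.mul_prod_erase s _ has, Function.update_self,
            Finset.prod_congr rfl fun i hi => by rw [hu i hi]] at e
          refine e.congr fun S => ?_
          congr 1
          ext t
          rw [← Finset.mul_prod_erase s _ has, Function.update_self]
          congr 1
          exact Finset.prod_congr rfl fun i hi => by rw [hu i hi]
        · rcases eq_or_ne i a with rfl | hi
          · rw [Function.update_self]; exact (fourier n).continuous.measurable
          · rw [Function.update_of_ne hi]; exact hm i
        · rcases eq_or_ne i a with rfl | hi
          · rw [Function.update_self]
            exact ((fourier n).norm_coe_le_norm x).trans (fourier_norm n).le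
          · rw [Function.update_of_ne hi]; exact hb i x
        · rcases eq_or_ne i a with rfl | hia
          · exact ⟨n, Function.update_self _ _ _⟩
          · rw [Function.update_of_ne hia]
            refine hf i ?_
            simp only [Finset.mem_sdiff, Finset.mem_insert] at hi ⊢
            tauto
  exact key s subset_rfl h hm hb (by simp)

end Circle

/-! ### The moments of `log |1 + z|²` on the unit circle -/

section LogMoments

open AddCircle

variable {T : ℝ}

/-- The function `log |1 + z|²` on the circle. -/
noncomputable def logSqNorm (x : AddCircle T) : ℝ :=
  Real.log (‖1 + fourier 1 x‖ ^ 2)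

/-- The function `log |1 + r z|²` on the circle. -/
noncomputable def logSqNormRadius (r : ℝ) (x : AddCircle T) : ℝ :=
  Real.log (‖1 + r * fourier 1 x‖ ^ 2)

lemma measurable_logSqNorm : Measurable (logSqNorm (T := T)) := by
  unfold logSqNorm
  have : Continuous fun x : AddCircle T => ‖1 + fourier 1 x‖ ^ 2 := by fun_prop
  exact Real.measurable_log.comp this.measurable

lemma measurable_logSqNormRadius (r : ℝ) : Measurable (logSqNormRadius (T := T) r) := by
  unfold logSqNormRadius
  have : Continuous fun x : AddCircle T => ‖1 + r * fourier 1 x‖ ^ 2 := by fun_prop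
  exact Real.measurable_log.comp this.measurable

lemma norm_fourier_apply (n : ℤ) (x : AddCircle T) : ‖fourier n x‖ = 1 := by
  rw [fourier_apply]; exact Circle.norm_coe _

lemma fourier_natCast (n : ℕ) (x : AddCircle T) : fourier (n : ℤ) x = fourier 1 x ^ n := by
  induction n with
  | zero => simp
  | succ n ih => rw [Nat.cast_succ, fourier_add, ih, pow_succ]

/-- Since `|1 + z| ≤ |1 + r z| + (1 - r)` and `1 - r ≤ |1 + r z|`, one has `|1 + z| / 2 ≤ |1 + r z|
≤ 2`. The resulting bound is uniform in `r` and serves as the dominating function for `r → 1`. -/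
lemma abs_logSqNormRadius_le {r : ℝ} (hr0 : 0 ≤ r) (hr1 : r ≤ 1) {x : AddCircle T}
    (hx : 1 + fourier 1 x ≠ 0) :
    |logSqNormRadius r x| ≤ |logSqNorm x| + 2 * Real.log 2 := by
  set z : ℂ := fourier 1 x with hz
  have hz1 : ‖z‖ = 1 := norm_fourier_apply 1 x
  have hrz : ‖(r : ℂ) * z‖ = r := by
    rw [norm_mul, hz1, mul_one, Complex.norm_real, Real.norm_of_nonneg hr0]
  have hpos : 0 < ‖1 + z‖ := norm_pos_iff.mpr hx
  have hlow : ‖1 + z‖ ≤ 2 * ‖1 + r * z‖ := by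
    have h1 : ‖1 + z‖ ≤ ‖1 + r * z‖ + (1 - r) := by
      calc ‖1 + z‖ = ‖(1 + r * z) + ((1 - r : ℝ) : ℂ) * z‖ := by congr 1; push_cast; ring
        _ ≤ _ := norm_add_le _ _
        _ = _ := by rw [norm_mul, hz1, mul_one, Complex.norm_real,
          Real.norm_of_nonneg (sub_nonneg.mpr hr1)]
    have h2 : 1 - r ≤ ‖1 + r * z‖ := by
      have := norm_sub_le (1 + r * z) (r * z)
      rw [add_sub_cancel_right, norm_one, hrz] at this
      linarith
    linarith
  have hup : ‖1 + r * z‖ ≤ 2 := by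
    refine (norm_add_le _ _).trans ?_
    rw [norm_one, hrz]
    linarith
  have hpos2 : 0 < ‖1 + r * z‖ := by linarith
  rw [logSqNormRadius, logSqNorm, ← hz, Real.log_pow, Real.log_pow]
  push_cast
  have h1 : Real.log ‖1 + r * z‖ ≤ Real.log 2 := Real.log_le_log hpos2 hup
  have h2 : Real.log ‖1 + z‖ ≤ Real.log 2 + Real.log ‖1 + r * z‖ := by
    rw [← Real.log_mul (by norm_num) hpos2.ne']
    exact Real.log_le_log hpos hlow
  rw [abs_mul, abs_mul, abs_of_pos (two_pos : (0 : ℝ) < 2)]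
  have h3 := neg_abs_le (Real.log ‖1 + z‖)
  have h4 := abs_nonneg (Real.log ‖1 + z‖)
  have : |Real.log ‖1 + r * z‖| ≤ |Real.log ‖1 + z‖| + Real.log 2 :=
    abs_le.mpr ⟨by linarith, by linarith⟩
  linarith

lemma tendsto_logSqNormRadius {x : AddCircle T} (hx : 1 + fourier 1 x ≠ 0) :
    Tendsto (fun k : ℕ => logSqNormRadius (1 - 1 / ((k : ℝ) + 1)) x) atTop (𝓝 (logSqNorm x)) := by
  have h1 : Tendsto (fun k : ℕ => 1 - 1 / ((k : ℝ) + 1)) atTop (𝓝 1) := by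
    simpa using tendsto_const_nhds (x := (1 : ℝ)).sub tendsto_one_div_add_atTop_nhds_zero_nat
  have hc : ContinuousAt (fun r : ℝ => logSqNormRadius r x) 1 := by
    unfold logSqNormRadius
    refine ContinuousAt.log (by fun_prop) ?_
    simpa using hx
  have := hc.tendsto.comp h1
  simpa [logSqNormRadius, logSqNorm, Function.comp_def] using this

variable [hT : Fact (0 < T)]

/-- The Taylor coefficients of `log (1 + r z)`. -/
noncomputable def logCoeff (r : ℝ) (n : ℕ) : ℂ :=
  (-1) ^ (n + 1) * (r : ℂ) ^ n / n

lemma norm_logCoeff_le {r : ℝ} (hr0 : 0 ≤ r) (n : ℕ) : ‖logCoeff r n‖ ≤ r ^ n := by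
  rw [logCoeff, norm_div, norm_mul, norm_pow, norm_pow, norm_neg, norm_one, one_pow, one_mul,
    Complex.norm_real, Real.norm_of_nonneg hr0, Complex.norm_natCast]
  rcases n.eq_zero_or_pos with rfl | hn
  · simp
  · exact div_le_self (by positivity) (by exact_mod_cast hn)

/-- The continuous function `log (1 + r z)` on the circle, as a power series. -/
noncomputable def logSeries (T r : ℝ) : C(AddCircle T, ℂ) :=
  ∑' n : ℕ, logCoeff r n • fourier (n : ℤ)

lemma hasSum_logSeries {r : ℝ} (hr0 : 0 ≤ r) (hr1 : r < 1) :
    HasSum (fun n : ℕ => logCoeff r n • fourier (T := T) (n : ℤ)) (logSeries T r) := by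
  refine Summable.hasSum (Summable.of_norm_bounded (summable_geometric_of_lt_one hr0 hr1)
    fun n => ?_)
  rw [norm_smul, fourier_norm, mul_one]
  exact norm_logCoeff_le hr0 n

lemma logSeries_apply {r : ℝ} (hr0 : 0 ≤ r) (hr1 : r < 1) (x : AddCircle T) :
    logSeries T r x = Complex.log (1 + r * fourier 1 x) := by
  have hz : ‖(r : ℂ) * fourier 1 x‖ < 1 := by
    rw [norm_mul, norm_fourier_apply, mul_one, Complex.norm_real, Real.norm_of_nonneg hr0]
    exact hr1
  have h1 := (hasSum_logSeries (T := T) hr0 hr1).mapL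
    (ContinuousMap.evalCLM ℂ x)
  refine h1.unique ((Complex.hasSum_taylorSeries_log hz).congr_fun ?_)
  intro n
  rw [ContinuousMap.evalCLM_apply, ContinuousMap.smul_apply, fourier_natCast, smul_eq_mul, logCoeff,
    mul_pow]
  ring

lemma logSqNormRadius_eq {r : ℝ} (hr0 : 0 ≤ r) (hr1 : r < 1) (x : AddCircle T) :
    logSqNormRadius r x = 2 * (logSeries T r x).re := by
  rw [logSeries_apply hr0 hr1, Complex.log_re, logSqNormRadius, Real.log_pow]
  norm_num

/-- The series converges in the sup norm, and integration against `g` is a continuous linear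
functional for it. -/
lemma hasSum_integral_logSeries_mul {r : ℝ} (hr0 : 0 ≤ r) (hr1 : r < 1) (g : C(AddCircle T, ℂ)) :
    HasSum (fun n : ℕ => logCoeff r n * ∫ x, fourier (n : ℤ) x * g x ∂haarAddCircle)
      (∫ x, logSeries T r x * g x ∂haarAddCircle) := by
  have hi : ∀ p : C(AddCircle T, ℂ), Integrable (fun x => p x * g x) haarAddCircle := fun p =>
    integrable_of_measurable_of_bound (p * g).continuous.measurable (p * g).norm_coe_le_norm
  let φ : C(AddCircle T, ℂ) →L[ℂ] ℂ := LinearMap.mkContinuous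
    { toFun := fun p => ∫ x, p x * g x ∂haarAddCircle
      map_add' := fun p q => by
        simp only [ContinuousMap.add_apply, add_mul]
        exact integral_add (hi p) (hi q)
      map_smul' := fun c p => by
        simp only [ContinuousMap.smul_apply, smul_eq_mul, mul_assoc, integral_const_mul,
          RingHom.id_apply] } ‖g‖ (fun p => by
        refine (norm_integral_le_of_norm_le_const (C := ‖g‖ * ‖p‖)
          (Eventually.of_forall fun x => ?_)).trans (by simp)
        rw [norm_mul, mul_comm]
        exact mul_le_mul (g.norm_coe_le_norm x) (p.norm_coe_le_norm x) (norm_nonneg _)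
          (norm_nonneg _))
  have h := (hasSum_logSeries (T := T) hr0 hr1).mapL φ
  simpa [φ, mul_assoc, integral_const_mul] using! h

lemma logCoeff_zero (r : ℝ) : logCoeff r 0 = 0 := by simp [logCoeff]

lemma integral_logSeries_mul_fourier {r : ℝ} (hr0 : 0 ≤ r) (hr1 : r < 1) (m : ℤ) :
    ∫ x, logSeries T r x * fourier m x ∂haarAddCircle =
      if m ≤ 0 then logCoeff r m.natAbs else 0 := by
  refine (hasSum_integral_logSeries_mul hr0 hr1 (fourier m)).unique ?_
  simp only [← fourier_add, integral_fourier]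
  split_ifs with hm
  · have h := hasSum_single (f := fun n : ℕ => logCoeff r n * if (n : ℤ) + m = 0 then 1 else 0)
      m.natAbs fun n hn => by rw [if_neg (by lia), mul_zero]
    rwa [if_pos (by lia), mul_one] at h
  · convert! hasSum_zero using 2 with n
    rw [if_neg (by lia), mul_zero]

lemma integral_logSeries {r : ℝ} (hr0 : 0 ≤ r) (hr1 : r < 1) :
    ∫ x, logSeries T r x ∂haarAddCircle = 0 := by
  simpa [logCoeff_zero] using integral_logSeries_mul_fourier (T := T) hr0 hr1 0

/-- Only strictly positive frequencies occur in `log (1 + r z)`, so its square has no constant term.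
-/
lemma integral_logSeries_sq {r : ℝ} (hr0 : 0 ≤ r) (hr1 : r < 1) :
    ∫ x, logSeries T r x * logSeries T r x ∂haarAddCircle = 0 := by
  refine (hasSum_integral_logSeries_mul hr0 hr1 (logSeries T r)).unique ?_
  convert! hasSum_zero using 2 with n
  simp_rw [mul_comm (fourier (n : ℤ) _)]
  rw [integral_logSeries_mul_fourier hr0 hr1]
  split_ifs with hn
  · obtain rfl : n = 0 := by lia
    simp [logCoeff_zero]
  · simp

lemma norm_logCoeff_sq (r : ℝ) (n : ℕ) : ‖logCoeff r n‖ ^ 2 = (r ^ 2) ^ n * (1 / (n : ℝ) ^ 2) := by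
  rw [logCoeff, norm_div, norm_mul, norm_pow, norm_pow, norm_neg, norm_one, one_pow, one_mul,
    Complex.norm_real, Complex.norm_natCast, div_pow, ← pow_mul, mul_comm n 2, pow_mul,
    Real.norm_eq_abs, sq_abs]
  ring

/-- Parseval: pairing the series with its conjugate leaves the squared moduli of the coefficients.
-/
lemma hasSum_integral_norm_logSeries_sq {r : ℝ} (hr0 : 0 ≤ r) (hr1 : r < 1) :
    HasSum (fun n : ℕ => (r ^ 2) ^ n * (1 / (n : ℝ) ^ 2))
      (∫ x, ‖logSeries T r x‖ ^ 2 ∂haarAddCircle) := by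
  have h := hasSum_integral_logSeries_mul hr0 hr1 (star (logSeries T r))
  have e : ∀ n : ℕ, logCoeff r n *
      ∫ x, fourier (n : ℤ) x * (star (logSeries T r)) x ∂haarAddCircle =
        (((r ^ 2) ^ n * (1 / (n : ℝ) ^ 2) : ℝ) : ℂ) := fun n => by
    have : ∀ x : AddCircle T, fourier (n : ℤ) x * (star (logSeries T r)) x =
        (starRingEnd ℂ) (logSeries T r x * fourier (-(n : ℤ)) x) := fun x => by
      rw [fourier_neg, map_mul, Complex.conj_conj, mul_comm]
      rfl
    simp_rw [this]
    rw [integral_conj, integral_logSeries_mul_fourier hr0 hr1, if_pos (by lia), Int.natAbs_neg,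
      Int.natAbs_natCast, Complex.mul_conj, Complex.normSq_eq_norm_sq, norm_logCoeff_sq]
  have e2 : ∫ x, logSeries T r x * (star (logSeries T r)) x ∂haarAddCircle =
      ((∫ x, ‖logSeries T r x‖ ^ 2 ∂haarAddCircle : ℝ) : ℂ) := by
    rw [← integral_complex_ofReal]
    congr 1
    ext x
    rw [ContinuousMap.star_apply, Complex.star_def, Complex.mul_conj, Complex.normSq_eq_norm_sq]
  simp_rw [e, e2] at h
  exact_mod_cast h

lemma integral_logSqNormRadius {r : ℝ} (hr0 : 0 ≤ r) (hr1 : r < 1) :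
    ∫ x : AddCircle T, logSqNormRadius r x ∂haarAddCircle = 0 := by
  have hi : Integrable (logSeries T r) haarAddCircle :=
    integrable_of_measurable_of_bound (logSeries T r).continuous.measurable
      (logSeries T r).norm_coe_le_norm
  simp_rw [logSqNormRadius_eq hr0 hr1]
  rw [integral_const_mul]
  have := integral_re hi
  simp only [RCLike.re_eq_complex_re] at this
  rw [this, integral_logSeries hr0 hr1]
  simp

/-- `(2 Re F)² = 2 |F|² + 2 Re F²`, and the last term has mean zero. -/
lemma integral_logSqNormRadius_sq {r : ℝ} (hr0 : 0 ≤ r) (hr1 : r < 1) :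
    ∫ x : AddCircle T, logSqNormRadius r x ^ 2 ∂haarAddCircle =
      2 * ∑' n : ℕ, (r ^ 2) ^ n * (1 / (n : ℝ) ^ 2) := by
  set F := logSeries T r with hF
  have hi : Integrable (fun x => F x * F x) haarAddCircle :=
    integrable_of_measurable_of_bound (F * F).continuous.measurable (F * F).norm_coe_le_norm
  have hn : Integrable (fun x => ‖F x‖ ^ 2) haarAddCircle := by
    refine hi.norm.congr (Eventually.of_forall fun x => ?_)
    simp [sq]
  have e : ∀ x : AddCircle T,
      logSqNormRadius r x ^ 2 = 2 * ‖F x‖ ^ 2 + 2 * (F x * F x).re := fun x => by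
    rw [logSqNormRadius_eq hr0 hr1, ← Complex.normSq_eq_norm_sq, Complex.normSq_apply,
      Complex.mul_re]
    ring
  have h3 := integral_re hi
  simp only [RCLike.re_eq_complex_re] at h3
  simp_rw [e]
  rw [integral_add (g := fun x => 2 * (F x * F x).re) (hn.const_mul 2) (hi.re.const_mul 2),
    integral_const_mul, integral_const_mul, h3, integral_logSeries_sq hr0 hr1,
    ← (hasSum_integral_norm_logSeries_sq hr0 hr1).tsum_eq]
  simp

/-- The terms are dominated by `1 / n²`, and the limit is `2 ζ(2)`. The index `n = 0` contributes
nothing, as division by zero gives `0`. -/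
lemma tendsto_tsum_pow_div_sq :
    Tendsto (fun k : ℕ => 2 * ∑' n : ℕ, ((1 - 1 / ((k : ℝ) + 1)) ^ 2) ^ n * (1 / (n : ℝ) ^ 2))
      atTop (𝓝 (Real.pi ^ 2 / 3)) := by
  rw [show Real.pi ^ 2 / 3 = 2 * (Real.pi ^ 2 / 6) by ring, ← hasSum_zeta_two.tsum_eq]
  refine Tendsto.const_mul _ (tendsto_tsum_of_dominated_convergence hasSum_zeta_two.summable
    (fun n => ?_) (Eventually.of_forall fun k n => ?_))
  · have h1 : Tendsto (fun k : ℕ => 1 - 1 / ((k : ℝ) + 1)) atTop (𝓝 (1 - 0)) :=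
      tendsto_const_nhds.sub tendsto_one_div_add_atTop_nhds_zero_nat
    have h2 := ((h1.pow 2).pow n).mul_const (1 / (n : ℝ) ^ 2)
    simpa using h2
  · have h0 : 0 ≤ 1 - 1 / ((k : ℝ) + 1) := by
      rw [sub_nonneg, div_le_one (by positivity)]; linarith [k.cast_nonneg (α := ℝ)]
    have h1 : 1 - 1 / ((k : ℝ) + 1) ≤ 1 := by
      have : 0 ≤ 1 / ((k : ℝ) + 1) := by positivity
      linarith
    rw [Real.norm_of_nonneg (by positivity)]
    exact mul_le_of_le_one_left (by positivity) (pow_le_one₀ (by positivity) (pow_le_one₀ h0 h1))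

/-- Injectivity of `toCircle` leaves at most one zero, and a point lies in balls of arbitrarily
small volume. -/
lemma ae_one_add_fourier_ne_zero :
    ∀ᵐ x : AddCircle T ∂haarAddCircle, 1 + fourier 1 x ≠ 0 := by
  have hsub : {x : AddCircle T | ¬ 1 + fourier 1 x ≠ 0}.Subsingleton := by
    intro x hx y hy
    simp only [ne_eq, not_not, Set.mem_ofPred_eq, fourier_one] at hx hy
    refine AddCircle.injective_toCircle hT.out.ne' (Circle.ext ?_)
    rw [← add_right_inj (1 : ℂ), hx, hy]
  rw [ae_iff]
  have hv : (volume : Measure (AddCircle T)) {x : AddCircle T | ¬ 1 + fourier 1 x ≠ 0} = 0 := by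
    refine le_antisymm (ENNReal.le_of_forall_pos_le_add fun ε hε _ => ?_) zero_le
    rcases hsub.eq_empty_or_singleton with h | ⟨a, h⟩
    · rw [h, measure_empty]; exact zero_le
    · rw [h]
      refine (measure_mono (Set.singleton_subset_iff.mpr
        (Metric.mem_closedBall_self (x := a) (ε := ε / 2) (by positivity)))).trans ?_
      rw [AddCircle.volume_closedBall, zero_add]
      refine (ENNReal.ofReal_le_ofReal (min_le_right _ _)).trans ?_
      rw [mul_div_cancel₀ _ two_ne_zero, ENNReal.ofReal_coe_nnreal]
  rw [volume_eq_smul_haarAddCircle, Measure.smul_apply, smul_eq_mul, mul_eq_zero] at hv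
  exact hv.resolve_left (by simpa using hT.out)

lemma one_sub_one_div_mem (k : ℕ) :
    0 ≤ 1 - 1 / ((k : ℝ) + 1) ∧ 1 - 1 / ((k : ℝ) + 1) < 1 := by
  have hk : (0 : ℝ) < (k : ℝ) + 1 := by positivity
  refine ⟨?_, by have : 0 < 1 / ((k : ℝ) + 1) := by positivity
                 linarith⟩
  rw [sub_nonneg, div_le_one hk]
  linarith [k.cast_nonneg (α := ℝ)]

lemma integrable_logSqNormRadius_sq {r : ℝ} (hr0 : 0 ≤ r) (hr1 : r < 1) :
    Integrable (fun x : AddCircle T => logSqNormRadius r x ^ 2) haarAddCircle := by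
  have : Continuous fun x : AddCircle T => logSqNormRadius r x ^ 2 := by
    simp_rw [logSqNormRadius_eq hr0 hr1]
    fun_prop
  exact this.integrable_of_hasCompactSupport (HasCompactSupport.of_compactSpace _)

/-- Fatou along `r → 1`. Dominated convergence is available only afterwards, because the dominating
function involves `logSqNorm` itself. -/
lemma memLp_two_logSqNorm : MemLp (logSqNorm (T := T)) 2 haarAddCircle := by
  rw [memLp_two_iff_integrable_sq measurable_logSqNorm.aestronglyMeasurable]
  refine ⟨(measurable_logSqNorm.pow_const 2).aestronglyMeasurable, ?_⟩
  have hb : ∀ x : AddCircle T, ‖logSqNorm x ^ 2‖ₑ = ENNReal.ofReal (logSqNorm x ^ 2) := fun x =>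
    Real.enorm_of_nonneg (sq_nonneg _)
  rw [hasFiniteIntegral_iff_enorm]
  simp_rw [hb]
  calc ∫⁻ x : AddCircle T, ENNReal.ofReal (logSqNorm x ^ 2) ∂haarAddCircle
      = ∫⁻ x : AddCircle T, liminf (fun k : ℕ => ENNReal.ofReal
          (logSqNormRadius (1 - 1 / ((k : ℝ) + 1)) x ^ 2)) atTop ∂haarAddCircle := by
        refine lintegral_congr_ae ?_
        filter_upwards [ae_one_add_fourier_ne_zero] with x hx
        exact ((ENNReal.continuous_ofReal.tendsto _).comp
          ((tendsto_logSqNormRadius hx).pow 2)).liminf_eq.symm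
    _ ≤ liminf (fun k : ℕ => ∫⁻ x : AddCircle T, ENNReal.ofReal
          (logSqNormRadius (1 - 1 / ((k : ℝ) + 1)) x ^ 2) ∂haarAddCircle) atTop :=
        lintegral_liminf_le fun k => ((measurable_logSqNormRadius _).pow_const 2).ennreal_ofReal
    _ = ENNReal.ofReal (Real.pi ^ 2 / 3) := by
        refine Tendsto.liminf_eq (((ENNReal.continuous_ofReal.tendsto _).comp
          tendsto_tsum_pow_div_sq).congr fun k => ?_)
        obtain ⟨h0, h1⟩ := one_sub_one_div_mem k
        rw [Function.comp_apply, ← integral_logSqNormRadius_sq (T := T) h0 h1,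
          ofReal_integral_eq_lintegral_ofReal (integrable_logSqNormRadius_sq h0 h1)
            (Eventually.of_forall fun x => sq_nonneg _)]
    _ < ⊤ := ENNReal.ofReal_lt_top

theorem integral_logSqNorm : ∫ x : AddCircle T, logSqNorm x ∂haarAddCircle = 0 := by
  have h := tendsto_integral_of_dominated_convergence (μ := haarAddCircle (T := T))
    (F := fun (k : ℕ) x => logSqNormRadius (1 - 1 / ((k : ℝ) + 1)) x) (f := logSqNorm)
    (fun x => |logSqNorm x| + 2 * Real.log 2)
    (fun k => (measurable_logSqNormRadius _).aestronglyMeasurable)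
    (((memLp_two_logSqNorm.integrable one_le_two).abs).add (integrable_const _))
    (fun k => ?_) ?_
  · refine tendsto_nhds_unique h (tendsto_const_nhds.congr fun k => ?_)
    obtain ⟨h0, h1⟩ := one_sub_one_div_mem k
    exact (integral_logSqNormRadius h0 h1).symm
  · filter_upwards [ae_one_add_fourier_ne_zero] with x hx
    obtain ⟨h0, h1⟩ := one_sub_one_div_mem k
    exact abs_logSqNormRadius_le h0 h1.le hx
  · filter_upwards [ae_one_add_fourier_ne_zero] with x hx using tendsto_logSqNormRadius hx

theorem integral_logSqNorm_sq :
    ∫ x : AddCircle T, logSqNorm x ^ 2 ∂haarAddCircle = Real.pi ^ 2 / 3 := by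
  have hmem : MemLp (fun x : AddCircle T => |logSqNorm x| + 2 * Real.log 2) 2 haarAddCircle :=
    memLp_two_logSqNorm.abs.add (memLp_const _)
  have h := tendsto_integral_of_dominated_convergence (μ := haarAddCircle (T := T))
    (F := fun (k : ℕ) x => logSqNormRadius (1 - 1 / ((k : ℝ) + 1)) x ^ 2)
    (f := fun x => logSqNorm x ^ 2)
    (fun x => (|logSqNorm x| + 2 * Real.log 2) ^ 2)
    (fun k => ((measurable_logSqNormRadius _).pow_const 2).aestronglyMeasurable)
    hmem.integrable_sq (fun k => ?_) ?_
  · refine tendsto_nhds_unique h (tendsto_tsum_pow_div_sq.congr fun k => ?_)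
    obtain ⟨h0, h1⟩ := one_sub_one_div_mem k
    exact (integral_logSqNormRadius_sq h0 h1).symm
  · filter_upwards [ae_one_add_fourier_ne_zero] with x hx
    obtain ⟨h0, h1⟩ := one_sub_one_div_mem k
    rw [norm_pow, Real.norm_eq_abs]
    exact pow_le_pow_left₀ (abs_nonneg _) (abs_logSqNormRadius_le h0 h1.le hx) 2
  · filter_upwards [ae_one_add_fourier_ne_zero] with x hx
    exact (tendsto_logSqNormRadius hx).pow 2

end LogMoments

/-! ### A central limit theorem for triangular arrays of multiples of one variable -/

lemma norm_prod_sub_prod_le_sum {ι : Type*} (s : Finset ι) {f g : ι → ℂ}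
    (hf : ∀ i ∈ s, ‖f i‖ ≤ 1) (hg : ∀ i ∈ s, ‖g i‖ ≤ 1) :
    ‖∏ i ∈ s, f i - ∏ i ∈ s, g i‖ ≤ ∑ i ∈ s, ‖f i - g i‖ := by
  classical
  induction s using Finset.induction_on with
  | empty => simp
  | insert a s ha ih =>
    have hf' : ∀ i ∈ s, ‖f i‖ ≤ 1 := fun i hi => hf i (Finset.mem_insert_of_mem hi)
    have hg' : ∀ i ∈ s, ‖g i‖ ≤ 1 := fun i hi => hg i (Finset.mem_insert_of_mem hi)
    rw [Finset.prod_insert ha, Finset.prod_insert ha, Finset.sum_insert ha]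
    have hP : ‖∏ i ∈ s, g i‖ ≤ 1 := by
      rw [norm_prod]; exact Finset.prod_le_one (fun _ _ => norm_nonneg _) hg'
    calc ‖f a * ∏ i ∈ s, f i - g a * ∏ i ∈ s, g i‖
        = ‖(f a - g a) * ∏ i ∈ s, g i + f a * (∏ i ∈ s, f i - ∏ i ∈ s, g i)‖ := by
          congr 1; ring
      _ ≤ ‖f a - g a‖ * ‖∏ i ∈ s, g i‖ + ‖f a‖ * ‖∏ i ∈ s, f i - ∏ i ∈ s, g i‖ := by
          refine (norm_add_le _ _).trans ?_
          rw [norm_mul, norm_mul]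
      _ ≤ ‖f a - g a‖ * 1 + 1 * ∑ i ∈ s, ‖f i - g i‖ := by
          gcongr
          · exact hf a (Finset.mem_insert_self a s)
          · exact ih hf' hg'
      _ = _ := by ring

/-- If `φ` agrees with the standard normal characteristic function to second order at `0`, then the
products of `φ (t a)` over uniformly small weights `a` with `∑ a ^ 2 = 1` converge to it. -/
theorem tendsto_prod_of_isLittleO {φ : ℝ → ℂ} (hφ1 : ∀ u, ‖φ u‖ ≤ 1)
    (hφ : (fun u => φ u - (1 - (u : ℂ) ^ 2 / 2)) =o[𝓝 0] fun u : ℝ => u ^ 2)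
    {ι : Type*} {s : ℕ → Finset ι} {a : ℕ → ι → ℝ}
    (hsum : ∀ᶠ L in atTop, ∑ i ∈ s L, a L i ^ 2 = 1)
    (hsmall : ∀ δ > 0, ∀ᶠ L in atTop, ∀ i ∈ s L, |a L i| ≤ δ) (t : ℝ) :
    Tendsto (fun L => ∏ i ∈ s L, φ (t * a L i)) atTop (𝓝 (Complex.exp (-(t : ℂ) ^ 2 / 2))) := by
  have hgauss : (fun u : ℝ => Complex.exp (-(u : ℂ) ^ 2 / 2) - (1 - (u : ℂ) ^ 2 / 2)) =o[𝓝 0]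
      fun u : ℝ => u ^ 2 := by
    -- The expansion of the Gaussian comes from the general second-order expansion, applied to the
    -- standard normal law.
    have h := taylor_charFun_two (P := gaussianReal 0 1) (X := id) aemeasurable_id
      (by simp) (by
        have := variance_id_gaussianReal (μ := 0) (v := 1)
        rw [variance_of_integral_eq_zero aemeasurable_id (by simp)] at this
        simpa using this)
    refine h.congr_left fun u => ?_
    rw [Measure.map_id, charFun_gaussianReal]
    congr 2
    simp
    ring
  have hD : (fun u : ℝ => φ u - Complex.exp (-(u : ℂ) ^ 2 / 2)) =o[𝓝 0] fun u : ℝ => u ^ 2 :=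
    (hφ.sub hgauss).congr_left fun u => by ring
  rw [Metric.tendsto_nhds]
  intro η hη
  -- The total error will be `c * t ^ 2 * ∑ a ^ 2 = c * t ^ 2 < η`; likewise `|a| ≤ δ / (|t| + 1)`
  -- forces `|t * a| < δ`.
  set c : ℝ := η / (t ^ 2 + 1) with hc
  have hc0 : 0 < c := by positivity
  obtain ⟨δ, hδ, hball⟩ := Metric.eventually_nhds_iff.mp (hD.def hc0)
  filter_upwards [hsum, hsmall (δ / (|t| + 1)) (by positivity)] with L h1 h2
  have e : Complex.exp (-(t : ℂ) ^ 2 / 2) =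
      ∏ i ∈ s L, Complex.exp (-((t * a L i : ℝ) : ℂ) ^ 2 / 2) := by
    rw [← Complex.exp_sum]
    congr 1
    have h3 : (∑ i ∈ s L, (a L i : ℂ) ^ 2) = 1 := by exact_mod_cast h1
    calc -(t : ℂ) ^ 2 / 2 = -(t : ℂ) ^ 2 / 2 * ∑ i ∈ s L, (a L i : ℂ) ^ 2 := by rw [h3, mul_one]
      _ = _ := by
        rw [Finset.mul_sum]
        refine Finset.sum_congr rfl fun i _ => ?_
        push_cast
        ring
  have hg1 : ∀ u : ℝ, ‖Complex.exp (-(u : ℂ) ^ 2 / 2)‖ ≤ 1 := fun u => by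
    rw [show (-(u : ℂ) ^ 2 / 2) = ((-u ^ 2 / 2 : ℝ) : ℂ) by push_cast; ring,
      Complex.norm_exp, Complex.ofReal_re, Real.exp_le_one_iff]
    nlinarith [sq_nonneg u]
  rw [dist_eq_norm, e]
  calc _ ≤ ∑ i ∈ s L, ‖φ (t * a L i) - Complex.exp (-((t * a L i : ℝ) : ℂ) ^ 2 / 2)‖ :=
        norm_prod_sub_prod_le_sum _ (fun i _ => hφ1 _) fun i _ => hg1 _
    _ ≤ ∑ i ∈ s L, c * t ^ 2 * a L i ^ 2 := by
        refine Finset.sum_le_sum fun i hi => ?_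
        have h4 : dist (t * a L i) 0 < δ := by
          rw [dist_zero_right, Real.norm_eq_abs, abs_mul]
          calc |t| * |a L i| ≤ |t| * (δ / (|t| + 1)) := by gcongr; exact h2 i hi
            _ < δ := by
              rw [mul_div_assoc', div_lt_iff₀ (by positivity)]
              nlinarith
        refine (hball h4).trans_eq ?_
        rw [Real.norm_of_nonneg (sq_nonneg _)]
        ring
    _ = c * t ^ 2 := by rw [← Finset.mul_sum, h1, mul_one]
    _ < η := by
        rw [hc, div_mul_eq_mul_div, div_lt_iff₀ (by positivity)]
        nlinarith

/-! ### Normalized degeneracies and their uniform smallness -/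

section Degeneracy

lemma degeneracy_pos {L : ℕ} {Λ : Fin L → ℝ} {ε : ℝ} (hε : ε ∈ distinctEnergies Λ) :
    0 < degeneracy Λ ε := by
  obtain ⟨k, _, rfl⟩ := Finset.mem_image.mp hε
  exact Finset.card_pos.mpr ⟨k, by simp⟩

lemma sumSqDegeneracy_nonneg {L : ℕ} (Λ : Fin L → ℝ) : 0 ≤ sumSqDegeneracy Λ :=
  Finset.sum_nonneg fun _ _ => sq_nonneg _

lemma sumSqDegeneracy_pos {L : ℕ} (hL : 0 < L) (Λ : Fin L → ℝ) : 0 < sumSqDegeneracy Λ := by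
  refine Finset.sum_pos (fun ε hε => ?_) ⟨Λ ⟨0, hL⟩, Finset.mem_image_of_mem _ (Finset.mem_univ _)⟩
  have := degeneracy_pos hε
  positivity

lemma sum_sq_degeneracy_div_sqrt {L : ℕ} (hL : 0 < L) (Λ : Fin L → ℝ) :
    ∑ ε ∈ distinctEnergies Λ, ((degeneracy Λ ε : ℝ) / √(sumSqDegeneracy Λ)) ^ 2 = 1 := by
  have h := sumSqDegeneracy_pos hL Λ
  simp_rw [div_pow, Real.sq_sqrt h.le]
  rw [← Finset.sum_div]
  exact div_self h.ne'

/-- The ratio is the sum of the `q`-th powers of the normalized weights, so it bounds each of them.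
Through this the Lyapunov condition makes the weights uniformly small. -/
lemma degeneracy_div_sqrt_rpow_le_lyapunovRatio {L : ℕ} {Λ : Fin L → ℝ} (q : ℝ)
    {ε : ℝ} (hε : ε ∈ distinctEnergies Λ) :
    ((degeneracy Λ ε : ℝ) / √(sumSqDegeneracy Λ)) ^ q ≤ lyapunovRatio q Λ := by
  rw [Real.div_rpow (Nat.cast_nonneg _) (Real.sqrt_nonneg _), Real.sqrt_eq_rpow,
    ← Real.rpow_mul (sumSqDegeneracy_nonneg Λ), one_div_mul_eq_div, lyapunovRatio]
  refine div_le_div_of_nonneg_right ?_ (Real.rpow_nonneg (sumSqDegeneracy_nonneg Λ) _)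
  exact Finset.single_le_sum (f := fun ε => (degeneracy Λ ε : ℝ) ^ q)
    (fun _ _ => Real.rpow_nonneg (Nat.cast_nonneg _) _) hε

lemma eventually_degeneracy_div_sqrt_le {Λ : (L : ℕ) → Fin L → ℝ} {q : ℝ} (hq : 0 < q)
    (hlim : Tendsto (fun L => lyapunovRatio q (Λ L)) atTop (𝓝 0)) {δ : ℝ} (hδ : 0 < δ) :
    ∀ᶠ L in atTop, ∀ ε ∈ distinctEnergies (Λ L),
      |(degeneracy (Λ L) ε : ℝ) / √(sumSqDegeneracy (Λ L))| ≤ δ := by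
  filter_upwards [hlim.eventually_lt_const (Real.rpow_pos_of_pos hδ q)] with L hL ε hε
  have h0 : 0 ≤ (degeneracy (Λ L) ε : ℝ) / √(sumSqDegeneracy (Λ L)) := by positivity
  rw [abs_of_nonneg h0, ← Real.rpow_le_rpow_iff h0 hδ.le hq]
  exact (degeneracy_div_sqrt_rpow_le_lyapunovRatio q hε).trans hL.le

end Degeneracy

/-! ### The amplitude of a free-fermion Hamiltonian -/

section Amplitude

lemma trace_exp_smul_of_isHermitian {n : Type*} [Fintype n] [DecidableEq n]
    {A : Matrix n n ℂ} (hA : A.IsHermitian) (c : ℂ) :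
    Matrix.trace (NormedSpace.exp (c • A)) =
      (A.charpoly.roots.map fun z => Complex.exp (c * z)).sum := by
  set U : Matrix n n ℂ := hA.eigenvectorUnitary.1 with hU
  have hUU : star U * U = 1 := Unitary.coe_star_mul_self hA.eigenvectorUnitary
  have hinv : U⁻¹ = star U := Matrix.inv_eq_left_inv hUU
  have hunit : IsUnit U := (Matrix.isUnit_iff_isUnit_det _).mpr
    (Matrix.isUnit_det_of_left_inverse hUU)
  have e : c • A = U * Matrix.diagonal (fun i => c * (hA.eigenvalues i : ℂ)) * U⁻¹ := by
    conv_lhs => rw [hA.spectral_theorem, Unitary.conjStarAlgAut_apply]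
    rw [hinv, ← smul_mul_assoc, ← mul_smul_comm, ← Matrix.diagonal_smul]
    rfl
  rw [e, Matrix.exp_conj _ _ hunit, Matrix.trace_mul_cycle, hinv, hUU, one_mul,
    Matrix.exp_diagonal, Matrix.trace_diagonal, hA.roots_charpoly_eq_eigenvalues,
    Multiset.map_map]
  refine Finset.sum_congr rfl fun i _ => ?_
  rw [Pi.coe_exp, Function.comp_apply, Complex.exp_eq_exp_ℂ]
  rfl

lemma chi_eq_prod {L : ℕ} {H : Matrix (Fin (2 ^ L)) (Fin (2 ^ L)) ℂ} {Λ : Fin L → ℝ} {E₀ : ℝ}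
    (hH : IsFreeFermion H Λ E₀) (t : ℝ) :
    chi H t = Complex.exp (-(Complex.I * t) * E₀) *
      ∏ k, (1 + Complex.exp (-(Complex.I * t) * Λ k)) := by
  rw [chi, trace_exp_smul_of_isHermitian hH.isHermitian, hH.eigenvalues_eq, Multiset.map_map]
  -- As sums over `Fin 2`, the factors multiply out to a sum over occupation configurations.
  have e : ∀ k, 1 + Complex.exp (-(Complex.I * t) * Λ k) =
      ∑ j : Fin 2, Complex.exp (-(Complex.I * t) * ((j : ℕ) * Λ k)) := fun k => by
    simp [Fin.sum_univ_two]
  simp_rw [e]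
  rw [Finset.prod_univ_sum, Finset.mul_sum, Fintype.piFinset_univ]
  refine Finset.sum_congr rfl fun n _ => ?_
  rw [← Complex.exp_sum, ← Complex.exp_add, Function.comp_apply, manyBodyEnergy]
  congr 1
  push_cast
  rw [mul_add, Finset.mul_sum, add_comm]

lemma norm_chi_eq_prod {L : ℕ} {H : Matrix (Fin (2 ^ L)) (Fin (2 ^ L)) ℂ} {Λ : Fin L → ℝ} {E₀ : ℝ}
    (hH : IsFreeFermion H Λ E₀) (t : ℝ) :
    ‖chi H t‖ = ∏ ε ∈ distinctEnergies Λ,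
      ‖1 + fourier 1 ((ε * t : ℝ) : AddCircle (2 * Real.pi))‖ ^ degeneracy Λ ε := by
  have h1 : ‖Complex.exp (-(Complex.I * t) * E₀)‖ = 1 := by
    rw [show -(Complex.I * t) * E₀ = ((-(t * E₀) : ℝ) : ℂ) * Complex.I by push_cast; ring]
    exact Complex.norm_exp_ofReal_mul_I _
  have h2 : ∀ ε : ℝ, ‖1 + Complex.exp (-(Complex.I * t) * ε)‖ =
      ‖1 + fourier 1 ((ε * t : ℝ) : AddCircle (2 * Real.pi))‖ := fun ε => by
    -- Conjugation turns `exp (-i t ε)` into the Fourier mode of index `1` without changing the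
    -- norm.
    rw [← Complex.norm_conj, map_add, map_one, ← Complex.exp_conj, fourier_coe_apply]
    congr 3
    have := Complex.ofReal_ne_zero.mpr Real.pi_ne_zero
    simp only [map_mul, map_neg, Complex.conj_I, Complex.conj_ofReal]
    push_cast
    field_simp
  rw [chi_eq_prod hH, norm_mul, h1, one_mul, norm_prod]
  simp_rw [h2]
  exact Finset.prod_comp (fun ε : ℝ => ‖1 + fourier 1 ((ε * t : ℝ) : AddCircle (2 * Real.pi))‖) Λ

lemma measurable_norm_chi {L : ℕ} {H : Matrix (Fin (2 ^ L)) (Fin (2 ^ L)) ℂ} {Λ : Fin L → ℝ}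
    {E₀ : ℝ} (hH : IsFreeFermion H Λ E₀) : Measurable fun t => ‖chi H t‖ := by
  simp_rw [norm_chi_eq_prod hH]
  have h : Continuous fun x : AddCircle (2 * Real.pi) => ‖1 + fourier 1 x‖ := by fun_prop
  exact Finset.measurable_fun_prod _ fun ε _ =>
    (measurable_comp_coe_mul h.measurable ε).pow_const _

lemma ae_one_add_fourier_mul_ne_zero {ε : ℝ} (hε : ε ≠ 0) :
    ∀ᵐ t : ℝ, 1 + fourier 1 ((ε * t : ℝ) : AddCircle (2 * Real.pi)) ≠ 0 := by
  -- A zero requires `ε * t` to be `π` modulo `2 π`.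
  have hc : (Set.range fun n : ℤ => (Real.pi + n * (2 * Real.pi)) / ε).Countable :=
    Set.countable_range _
  filter_upwards [hc.ae_notMem volume] with t ht h0
  refine ht ?_
  rw [fourier_coe_apply, add_comm, add_eq_zero_iff_eq_neg, ← Complex.exp_pi_mul_I,
    Complex.exp_eq_exp_iff_exists_int] at h0
  obtain ⟨n, hn⟩ := h0
  refine ⟨n, ?_⟩
  have hpi := Complex.ofReal_ne_zero.mpr Real.pi_ne_zero
  have h1 : ((ε * t : ℝ) : ℂ) * Complex.I = ((Real.pi + n * (2 * Real.pi) : ℝ) : ℂ) * Complex.I := by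
    calc _ = 2 * Real.pi * Complex.I * (1 : ℤ) * ((ε * t : ℝ) : ℂ) / ((2 * Real.pi : ℝ) : ℂ) := by
          push_cast
          field_simp
      _ = _ := by
          rw [hn]
          push_cast
          ring
  have h2 := Complex.ofReal_injective (mul_right_cancel₀ Complex.I_ne_zero h1)
  simp only
  rw [← h2, mul_div_cancel_left₀ _ hε]

/-- The logarithm of the product splits only where no factor vanishes; the exceptional times form a
null set, invisible to time averages. -/
lemma ae_chi_ne_zero {L : ℕ} {H : Matrix (Fin (2 ^ L)) (Fin (2 ^ L)) ℂ} {Λ : Fin L → ℝ} {E₀ : ℝ}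
    (hH : IsFreeFermion H Λ E₀) (h0 : ∀ ε ∈ distinctEnergies Λ, ε ≠ 0) :
    ∀ᵐ t : ℝ, ‖chi H t‖ ≠ 0 ∧ Real.log (‖chi H t‖ ^ 2) =
      ∑ ε ∈ distinctEnergies Λ,
        degeneracy Λ ε * logSqNorm ((ε * t : ℝ) : AddCircle (2 * Real.pi)) := by
  have h : ∀ᵐ t : ℝ, ∀ ε ∈ distinctEnergies Λ,
      1 + fourier 1 ((ε * t : ℝ) : AddCircle (2 * Real.pi)) ≠ 0 :=
    (Finset.eventually_all _).mpr fun ε hε => ae_one_add_fourier_mul_ne_zero (h0 ε hε)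
  filter_upwards [h] with t ht
  have ht' : ∀ ε ∈ distinctEnergies Λ,
      ‖1 + fourier 1 ((ε * t : ℝ) : AddCircle (2 * Real.pi))‖ ^ degeneracy Λ ε ≠ 0 :=
    fun ε hε => pow_ne_zero _ (norm_ne_zero_iff.mpr (ht ε hε))
  rw [norm_chi_eq_prod hH]
  refine ⟨Finset.prod_ne_zero_iff.mpr ht', ?_⟩
  rw [Real.log_pow, Real.log_prod ht', Finset.mul_sum]
  refine Finset.sum_congr rfl fun ε _ => ?_
  rw [logSqNorm, Real.log_pow, Real.log_pow]
  ring

end Amplitude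

/-! ### Distributions with respect to time -/

lemma HasTimeLaw.congr_ae {X Y : ℝ → ℝ} {μ : ProbabilityMeasure ℝ} (hX : HasTimeLaw X μ)
    (hY : Measurable Y) (h : X =ᵐ[volume] Y) : HasTimeLaw Y μ := by
  refine ⟨hY, fun f => (hX.2 f).congr fun S => ?_⟩
  congr 1
  refine intervalIntegral.integral_congr_ae ?_
  filter_upwards [h] with t ht _ using by rw [ht]

lemma HasTimeLaw.comp_continuous {X : ℝ → ℝ} {μ : ProbabilityMeasure ℝ} (hX : HasTimeLaw X μ)
    {φ : ℝ → ℝ} (hφ : Continuous φ) :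
    HasTimeLaw (fun t => φ (X t)) (μ.map hφ.measurable.aemeasurable) := by
  refine ⟨hφ.measurable.comp hX.1, fun f => ?_⟩
  have h := hX.2 (f.compContinuous ⟨φ, hφ⟩)
  rw [ProbabilityMeasure.toMeasure_map,
    integral_map hφ.measurable.aemeasurable f.continuous.aestronglyMeasurable]
  exact h

/-- The law of `X` at a time distributed uniformly on `(0, S]`. -/
noncomputable def uniformTimeLaw {X : ℝ → ℝ} (hX : Measurable X) {S : ℝ} (hS : 0 < S) :
    ProbabilityMeasure ℝ :=
  ⟨(cond volume (Set.Ioc 0 S)).map X, by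
    have : IsProbabilityMeasure (cond (volume : Measure ℝ) (Set.Ioc 0 S)) :=
      cond_isProbabilityMeasure_of_finite (by simp [hS]) (by simp)
    exact Measure.isProbabilityMeasure_map hX.aemeasurable⟩

lemma integral_uniformTimeLaw {E : Type*} [NormedAddCommGroup E] [NormedSpace ℝ E]
    {X : ℝ → ℝ} (hX : Measurable X) {S : ℝ} (hS : 0 < S) {f : ℝ → E} (hf : Continuous f)
    [SecondCountableTopology E] :
    ∫ x, f x ∂(uniformTimeLaw hX hS : Measure ℝ) = timeAverage (fun t => f (X t)) S := by
  rw [uniformTimeLaw, ProbabilityMeasure.coe_mk,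
    integral_map hX.aemeasurable hf.aestronglyMeasurable, ProbabilityTheory.cond,
    integral_smul_measure, timeAverage, intervalIntegral.integral_of_le hS.le]
  simp [hS.le]

/-- Lévy's continuity theorem for time averages. -/
lemma hasTimeLaw_of_tendsto_charFun {X : ℝ → ℝ} (hX : Measurable X) {μ : ProbabilityMeasure ℝ}
    (h : ∀ u : ℝ, Tendsto (timeAverage fun t => Complex.exp (u * X t * Complex.I)) atTop
      (𝓝 (charFun (μ : Measure ℝ) u))) : HasTimeLaw X μ := by
  refine ⟨hX, fun f => ?_⟩
  -- Lévy's theorem is used along sequences of times. The maximum with `1` keeps every uniform law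
  -- defined and is eventually inactive.
  refine tendsto_of_seq_tendsto fun S hS => ?_
  have hpos : ∀ n, 0 < max (S n) 1 := fun n => lt_max_of_lt_right one_pos
  have hmax : Tendsto (fun n => max (S n) 1) atTop atTop :=
    tendsto_atTop_mono (fun n => le_max_left _ _) hS
  have hlim : Tendsto (fun n => uniformTimeLaw hX (hpos n)) atTop (𝓝 μ) := by
    refine ProbabilityMeasure.tendsto_of_tendsto_charFun fun u => ?_
    refine ((h u).comp hmax).congr fun n => ?_
    rw [charFun_apply_real, integral_uniformTimeLaw hX (hpos n) (by fun_prop)]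
    rfl
  refine (ProbabilityMeasure.tendsto_iff_forall_integral_tendsto.mp hlim f).congr' ?_
  filter_upwards [hS.eventually_ge_atTop 1] with n hn
  rw [integral_uniformTimeLaw hX (hpos n) f.continuous, timeAverage, max_eq_left hn, smul_eq_mul,
    Function.comp_apply, one_div]

/-- A sum of functions of phases rotating with rationally independent frequencies is distributed
like the corresponding sum over independent uniform phases. -/
theorem exists_hasTimeLaw_sum {T : ℝ} [Fact (0 < T)] {ι : Type*} (s : Finset ι) {ω : ι → ℝ}
    (hω : ∀ n : ι → ℤ, ∑ i ∈ s, (n i : ℝ) * ω i = 0 → ∀ i ∈ s, n i = 0)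
    {y : AddCircle T → ℝ} (hy : Measurable y) (a : ι → ℝ) :
    ∃ μ : ProbabilityMeasure ℝ,
      HasTimeLaw (fun t => ∑ i ∈ s, a i * y ((ω i * t : ℝ) : AddCircle T)) μ ∧
      ∀ u : ℝ, charFun (μ : Measure ℝ) u =
        ∏ i ∈ s, charFun (AddCircle.haarAddCircle.map y) (u * a i) := by
  classical
  have hchar : ∀ v : ℝ, charFun (AddCircle.haarAddCircle.map y) v =
      ∫ x, Complex.exp (v * y x * Complex.I) ∂AddCircle.haarAddCircle := fun v => by
    rw [charFun_apply_real, integral_map hy.aemeasurable (by fun_prop)]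
  have hmeas : Measurable fun x : s → AddCircle T => ∑ i : s, a i * y (x i) :=
    Finset.measurable_fun_sum _ fun i _ => (hy.comp (measurable_pi_apply i)).const_mul _
  let μ : ProbabilityMeasure ℝ :=
    ⟨(Measure.pi fun _ : s => AddCircle.haarAddCircle (T := T)).map
      fun x => ∑ i : s, a i * y (x i), Measure.isProbabilityMeasure_map hmeas.aemeasurable⟩
  have hμ : ∀ u : ℝ, charFun (μ : Measure ℝ) u =
      ∏ i ∈ s, charFun (AddCircle.haarAddCircle.map y) (u * a i) := fun u => by
    rw [ProbabilityMeasure.coe_mk, charFun_apply_real, integral_map hmeas.aemeasurable (by fun_prop),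
      ← Finset.prod_coe_sort]
    simp_rw [hchar]
    rw [← integral_fintype_prod_eq_prod
      (fun (i : s) (x : AddCircle T) => Complex.exp ((u * a i : ℝ) * y x * Complex.I))]
    congr 1
    ext x
    rw [← Complex.exp_sum]
    push_cast
    rw [Finset.mul_sum, Finset.sum_mul]
    congr 1
    refine Finset.sum_congr rfl fun i _ => ?_
    ring
  refine ⟨μ, hasTimeLaw_of_tendsto_charFun ?_ fun u => ?_, hμ⟩
  · exact Finset.measurable_fun_sum _ fun i _ => (measurable_comp_coe_mul hy (ω i)).const_mul _
  · rw [hμ]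
    simp_rw [hchar]
    -- The exponentials have modulus one, so `y` itself need not be bounded.
    refine (tendsto_timeAverage_prod (T := T) s hω
      (h := fun i x => Complex.exp ((u * a i : ℝ) * y x * Complex.I))
      (fun i => by fun_prop) (fun i x => ?_)).congr fun S => ?_
    · rw [← Complex.ofReal_mul]
      exact (Complex.norm_exp_ofReal_mul_I _).le
    · congr 1
      ext t
      rw [← Complex.exp_sum]
      push_cast
      rw [Finset.mul_sum, Finset.sum_mul]
      congr 1
      refine Finset.sum_congr rfl fun i _ => ?_
      ring

/-! ### Normalization of the logarithmic variable and the limit laws -/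

lemma isLittleO_charFun_logSqNorm {T : ℝ} [Fact (0 < T)] :
    (fun u : ℝ => charFun ((AddCircle.haarAddCircle (T := T)).map logSqNorm)
      ((√(Real.pi ^ 2 / 3))⁻¹ * u) - (1 - (u : ℂ) ^ 2 / 2)) =o[𝓝 0] fun u : ℝ => u ^ 2 := by
  have hσ : 0 < Real.pi ^ 2 / 3 := by positivity
  -- The inverse standard deviation: `c * logSqNorm` has variance one.
  set c : ℝ := (√(Real.pi ^ 2 / 3))⁻¹ with hc
  have hc2 : c ^ 2 = (Real.pi ^ 2 / 3)⁻¹ := by rw [hc, inv_pow, Real.sq_sqrt hσ.le]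
  have h := taylor_charFun_two (P := AddCircle.haarAddCircle (T := T))
    (X := fun x => c * logSqNorm x) (measurable_logSqNorm.const_mul c).aemeasurable
    (by rw [integral_const_mul, integral_logSqNorm, mul_zero])
    (by
      simp only [Pi.pow_apply, mul_pow]
      rw [integral_const_mul, integral_logSqNorm_sq, hc2, inv_mul_cancel₀ hσ.ne'])
  refine h.congr_left fun u => ?_
  congr 1
  rw [charFun_apply_real, charFun_apply_real,
    integral_map (measurable_logSqNorm.const_mul c).aemeasurable (by fun_prop),
    integral_map measurable_logSqNorm.aemeasurable (by fun_prop)]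
  congr 1
  ext x
  push_cast
  congr 1
  ring

lemma variance_uniform_two_pi :
    variance (fun x : ℝ => x) (cond volume (Set.Icc 0 (2 * Real.pi))) = Real.pi ^ 2 / 3 := by
  have hpi := Real.pi_pos
  have hprob : IsProbabilityMeasure (cond (volume : Measure ℝ) (Set.Icc 0 (2 * Real.pi))) :=
    cond_isProbabilityMeasure_of_finite (by simp [hpi]) measure_Icc_lt_top.ne
  have hint : ∀ f : ℝ → ℝ, ∫ x, f x ∂(cond volume (Set.Icc 0 (2 * Real.pi))) =
      (2 * Real.pi)⁻¹ * ∫ x in (0 : ℝ)..(2 * Real.pi), f x := fun f => by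
    rw [ProbabilityTheory.cond, integral_smul_measure, integral_Icc_eq_integral_Ioc,
      ← intervalIntegral.integral_of_le (by positivity)]
    simp [hpi.le]
  have hmem : MemLp (fun x : ℝ => x) 2 (cond volume (Set.Icc 0 (2 * Real.pi))) := by
    refine MemLp.of_bound (by fun_prop) (2 * Real.pi) ?_
    filter_upwards [ae_cond_mem measurableSet_Icc] with x hx
    rw [Real.norm_of_nonneg hx.1]
    exact hx.2
  rw [variance_eq_sub hmem]
  simp only [Pi.pow_apply]
  rw [hint, hint, integral_pow, integral_id]
  field_simp
  ring

theorem theorem5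
    (Λ : (L : ℕ) → Fin L → ℝ) (E₀ : ℕ → ℝ)
    (H : (L : ℕ) → Matrix (Fin (2 ^ L)) (Fin (2 ^ L)) ℂ)
    (hH : ∀ L, IsFreeFermion (H L) (Λ L) (E₀ L))
    (hind : ∀ L, LinearIndepOn ℚ (id : ℝ → ℝ) (distinctEnergies (Λ L) : Set ℝ))
    (hgen : ∃ q : ℝ, 2 < q ∧ Tendsto (fun L => lyapunovRatio q (Λ L)) atTop (𝓝 0)) :
    (∃ μ : ℕ → ProbabilityMeasure ℝ,
      (∀ L, HasTimeLaw
        (fun t => Real.log (‖chi (H L) t‖ ^ 2) / √(sumSqDegeneracy (Λ L))) (μ L)) ∧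
      Tendsto μ atTop (𝓝 (normalLaw 0 (Real.toNNReal (Real.pi ^ 2 / 3))))) ∧
    (∃ ν : ℕ → ProbabilityMeasure ℝ,
      (∀ L, HasTimeLaw
        (fun t => ‖chi (H L) t‖ ^ (2 / √(sumSqDegeneracy (Λ L)))) (ν L)) ∧
      Tendsto ν atTop (𝓝 (logNormalLaw 0 (Real.toNNReal (Real.pi ^ 2 / 3))))) ∧
    variance (fun x : ℝ => x) (cond volume (Set.Icc 0 (2 * Real.pi))) = Real.pi ^ 2 / 3 := by
  have : Fact (0 < 2 * Real.pi) := ⟨Real.two_pi_pos⟩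
  obtain ⟨q, hq, hlim⟩ := hgen
  have hω : ∀ L, ∀ n : ℝ → ℤ, ∑ ε ∈ distinctEnergies (Λ L), (n ε : ℝ) * ε = 0 →
      ∀ ε ∈ distinctEnergies (Λ L), n ε = 0 := fun L n hn ε hε => by
    have h := linearIndepOn_finset_iff.mp (hind L) (fun ε => (n ε : ℚ))
      (by simpa [Rat.smul_def] using hn) ε hε
    exact_mod_cast h
  -- A linearly independent family cannot contain `0`.
  have hne : ∀ L, ∀ ε ∈ distinctEnergies (Λ L), ε ≠ 0 := fun L ε hε => (hind L).ne_zero hε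
  choose μ hμ hμchar using fun L => exists_hasTimeLaw_sum (T := 2 * Real.pi)
    (distinctEnergies (Λ L)) (hω L) measurable_logSqNorm
    (fun ε => (degeneracy (Λ L) ε : ℝ) / √(sumSqDegeneracy (Λ L)))
  have hlaw : ∀ L, HasTimeLaw
      (fun t => Real.log (‖chi (H L) t‖ ^ 2) / √(sumSqDegeneracy (Λ L))) (μ L) := fun L => by
    refine (hμ L).congr_ae
      ((Real.measurable_log.comp ((measurable_norm_chi (hH L)).pow_const 2)).div_const _) ?_
    filter_upwards [ae_chi_ne_zero (hH L) (hne L)] with t ht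
    rw [ht.2, Finset.sum_div]
    refine Finset.sum_congr rfl fun ε _ => ?_
    ring
  have hconv : Tendsto μ atTop (𝓝 (normalLaw 0 (Real.toNNReal (Real.pi ^ 2 / 3)))) := by
    have hσ : 0 < Real.pi ^ 2 / 3 := by positivity
    refine ProbabilityMeasure.tendsto_of_tendsto_charFun fun u => ?_
    -- Applied to the variable rescaled to unit variance; evaluation at `√(π² / 3) * u` undoes the
    -- rescaling.
    have h := tendsto_prod_of_isLittleO
      (φ := fun v => charFun ((AddCircle.haarAddCircle (T := 2 * Real.pi)).map logSqNorm)
        ((√(Real.pi ^ 2 / 3))⁻¹ * v))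
      (fun v => by
        have := Measure.isProbabilityMeasure_map (μ := AddCircle.haarAddCircle (T := 2 * Real.pi))
          measurable_logSqNorm.aemeasurable
        exact norm_charFun_le_one _)
      isLittleO_charFun_logSqNorm
      (s := fun L => distinctEnergies (Λ L))
      (a := fun L ε => (degeneracy (Λ L) ε : ℝ) / √(sumSqDegeneracy (Λ L)))
      ((eventually_gt_atTop 0).mono fun L hL => sum_sq_degeneracy_div_sqrt hL (Λ L))
      (fun δ hδ => eventually_degeneracy_div_sqrt_le (by linarith) hlim hδ)
      (√(Real.pi ^ 2 / 3) * u)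
    have e : charFun (normalLaw 0 (Real.toNNReal (Real.pi ^ 2 / 3)) : Measure ℝ) u =
        Complex.exp (-((√(Real.pi ^ 2 / 3) * u : ℝ) : ℂ) ^ 2 / 2) := by
      rw [normalLaw, ProbabilityMeasure.coe_mk, charFun_gaussianReal,
        Real.coe_toNNReal _ hσ.le, Complex.ofReal_mul, mul_pow, ← Complex.ofReal_pow (√_),
        Real.sq_sqrt hσ.le, Complex.ofReal_zero]
      congr 1
      ring
    rw [e]
    refine h.congr fun L => ?_
    rw [hμchar]
    refine Finset.prod_congr rfl fun ε _ => ?_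
    rw [← mul_assoc, ← mul_assoc, inv_mul_cancel₀ (Real.sqrt_pos.mpr hσ).ne', one_mul]
  refine ⟨⟨μ, hlaw, hconv⟩, ⟨fun L => (μ L).map Real.measurable_exp.aemeasurable, fun L => ?_,
    ProbabilityMeasure.tendsto_map_of_tendsto_of_continuous μ _ hconv Real.continuous_exp⟩,
    variance_uniform_two_pi⟩
  -- Away from zeros of `χ`, the real power is the exponential of the normalized logarithm.
  refine ((hlaw L).comp_continuous Real.continuous_exp).congr_ae
    ((measurable_norm_chi (hH L)).pow_const _) ?_
  filter_upwards [ae_chi_ne_zero (hH L) (hne L)] with t ht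
  rw [Real.rpow_def_of_pos (lt_of_le_of_ne (norm_nonneg _) ht.1.symm), Real.log_pow]
  congr 1
  push_cast
  ring
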